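/- Let $X_i=\theta_i+\varepsilon_i$, $1\le i\le n$, with $\varepsilon_1,\dots,\varepsilon_n$ i.i.d. $\mathcal N(0,1)$ and unknown $\theta\in\mathbb R^n$; write $P_\theta$, $E_\theta$ for the law of $X$ and the corresponding expectation. A multiple testing procedure is a measurable map $\varphi:\mathbb R^n\to\{0,1\}^n$ ($\varphi_i=1$ meaning that the hypothesis $\theta_i=0$ is rejected). Set $$\mathfrak R(\theta,\varphi)=\mathrm{FDR}(\theta,\varphi)+\mathrm{FNR}(\theta,\varphi) =E_\theta\left[\frac{\sum_{i}\mathbf 1\{\theta_i=0\}\varphi_i(X)}{1\vee\sum_{i}\varphi_i(X)}\right] +E_\theta\left[\frac{\sum_{i}\mathbf 1\{\theta_i\ne0\}(1-\varphi_i(X))}{1\vee\sum_{i}\mathbf 1\{\theta_i\neq0\}}\right].$$ Let $(s_n)$ be a sequence of nonnegative integers with $s_n\to\infty$ and $n/s_n\to\infty$ as $n\to\infty$. For $b\in\mathbb R$ let $\Theta_b$ be the set of all $\theta\in\mathbb R^n$ with exactly $s_n$ nonzero coordinates, each satisfying $|\theta_i|\ge\sqrt{2\log(n/s_n)}+b$.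 Let $\overline\Phi=1-\Phi$, where $\Phi$ is the standard normal distribution function. (i) For every fixed $b\in\mathbb R$, and also for every real sequence $b=b_n\to+\infty$ and every real sequence $b=b_n\to-\infty$, $$\inf_\varphi\sup_{\theta\in\Theta_b}\mathfrak R(\theta,\varphi)=\overline\Phi(b)+o(1)\qquad(n\to\infty),$$ the infimum being over all multiple testing procedures. (ii) The function $\overline\Phi$ is continuous and strictly decreasing, with limit $0$ at $+\infty$ and $1$ at $-\infty$. So the minimax risk tends to $0$ if $b=b_n\to+\infty$ and to $1$ if $b=b_n\to-\infty$ (a sharp phase transition from $0$ to $1$). (iii) The oracle thresholding procedure $\varphi^*_i=\mathbf 1\{|X_i|\ge\sqrt{2\log(n/s_n)}\}$, which does not depend on $b$, is asymptotically minimax: for every fixed $b\in\mathbb R$ and every sequence $b=b_n\to+\infty$, $$\sup_{\theta\in\Theta_b}\mathfrak R(\theta,\varphi^*)-\inf_\varphi\sup_{\theta\in\Theta_b}\mathfrak R(\theta,\varphi)\to0\qquad(n\to\infty).$$ -/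

import Mathlib

open MeasureTheory ProbabilityTheory Filter Topology

namespace MultipleTesting

noncomputable section

/-- The Gaussian upper tail `1 - Φ(x)`, with `Φ` the standard normal distribution function. -/
def gaussTail (x : ℝ) : ℝ := 1 - cdf (gaussianReal 0 1) x

/-- The law `P_θ` of `X = (X₁, …, Xₙ)`, where `X_i = θ_i + ε_i` with `ε_i` i.i.d. `N(0,1)`
(see `dataLaw_eq_map`). -/
def dataLaw {n : ℕ} (θ : Fin n → ℝ) : Measure (Fin n → ℝ) :=
  Measure.pi fun i => gaussianReal (θ i) 1

instance {n : ℕ} (θ : Fin n → ℝ) : IsProbabilityMeasure (dataLaw θ) := by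
  unfold dataLaw; infer_instance

theorem dataLaw_eq_map {n : ℕ} (θ : Fin n → ℝ) :
    dataLaw θ =
      (Measure.pi fun _ : Fin n => gaussianReal 0 1).map fun ε i => θ i + ε i := by
  have h := Measure.pi_map_pi (μ := fun _ : Fin n => gaussianReal 0 1)
    (f := fun i (x : ℝ) => θ i + x) (fun i => (measurable_const_add (θ i)).aemeasurable)
  rw [h]
  simp [dataLaw, gaussianReal_map_const_add]

/-- A multiple testing procedure: a measurable map of the data to `{0,1}ⁿ`; the value `true` in
coordinate `i` means that the `i`-th null hypothesis `θ_i = 0` is rejected. -/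
structure Procedure (n : ℕ) where
  reject : (Fin n → ℝ) → Fin n → Bool
  measurable_reject : Measurable reject

instance {n : ℕ} : Nonempty (Procedure n) := ⟨⟨fun _ _ => false, measurable_const⟩⟩

/-- The support `S_θ` of `θ`. -/
def support {n : ℕ} (θ : Fin n → ℝ) : Finset (Fin n) := {i | θ i ≠ 0}

/-- False discovery proportion of `φ` at `θ` on the data `x`. -/
def FDP {n : ℕ} (θ : Fin n → ℝ) (φ : Procedure n) (x : Fin n → ℝ) : ℝ :=
  (∑ i, if θ i = 0 ∧ φ.reject x i = true then (1 : ℝ) else 0) /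
    max 1 (∑ i, if φ.reject x i = true then (1 : ℝ) else 0)

/-- False negative proportion of `φ` at `θ` on the data `x`. -/
def FNP {n : ℕ} (θ : Fin n → ℝ) (φ : Procedure n) (x : Fin n → ℝ) : ℝ :=
  (∑ i, if θ i ≠ 0 ∧ φ.reject x i = false then (1 : ℝ) else 0) /
    max 1 (∑ i, if θ i ≠ 0 then (1 : ℝ) else 0)

/-- False discovery rate. -/
def FDR {n : ℕ} (θ : Fin n → ℝ) (φ : Procedure n) : ℝ := ∫ x, FDP θ φ x ∂dataLaw θ

/-- False negative rate. -/
def FNR {n : ℕ} (θ : Fin n → ℝ) (φ : Procedure n) : ℝ := ∫ x, FNP θ φ x ∂dataLaw θ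

/-- The combined risk `FDR + FNR`. -/
def risk {n : ℕ} (θ : Fin n → ℝ) (φ : Procedure n) : ℝ := FDR θ φ + FNR θ φ

/-- The worst-case combined risk of `φ` over `Θ` (a supremum of numbers in `[0, 2]`, see
`risk_mem_Icc`). -/
def supRisk {n : ℕ} (Θ : Set (Fin n → ℝ)) (φ : Procedure n) : ℝ := ⨆ θ : Θ, risk θ.1 φ

/-- The minimax combined risk over `Θ`, the infimum being over all procedures. -/
def minimaxRisk {n : ℕ} (Θ : Set (Fin n → ℝ)) : ℝ := ⨅ φ : Procedure n, supRisk Θ φ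

/-- The beta-min class `Θ(a, s)`: vectors with exactly `s` nonzero coordinates, each of absolute
value at least `a`. -/
def betaMinClass (n s : ℕ) (a : ℝ) : Set (Fin n → ℝ) :=
  {θ | (support θ).card = s ∧ ∀ i ∈ support θ, a ≤ |θ i|}

/-- The oracle threshold `√(2 log(n/s))`. -/
def oracleThreshold (n s : ℕ) : ℝ := Real.sqrt (2 * Real.log ((n : ℝ) / (s : ℝ)))

/-- The class `Θ_b = Θ(a_b, s)` with `a_b = √(2 log(n/s)) + b`. -/
def boundaryClass (n s : ℕ) (b : ℝ) : Set (Fin n → ℝ) :=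
  betaMinClass n s (oracleThreshold n s + b)

/-- The oracle thresholding procedure, rejecting the `i`-th null iff `|x_i| ≥ √(2 log(n/s))`. -/
def oracleProcedure (n s : ℕ) : Procedure n where
  reject x i := decide (oracleThreshold n s ≤ |x i|)
  measurable_reject := by
    refine measurable_pi_lambda _ fun i => measurable_to_bool ?_
    have h : (fun x : Fin n → ℝ => decide (oracleThreshold n s ≤ |x i|)) ⁻¹' {true} =
        {x | oracleThreshold n s ≤ |x i|} := by ext x; simp
    rw [h]
    exact measurableSet_le measurable_const (by fun_prop)

/-! The risks are expectations of bounded measurable functions. -/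

theorem measurable_FDP {n : ℕ} (θ : Fin n → ℝ) (φ : Procedure n) : Measurable (FDP θ φ) := by
  have h : ∀ f : (Fin n → Bool) → ℝ, Measurable fun x => f (φ.reject x) := fun f =>
    (measurable_of_finite f).comp φ.measurable_reject
  exact h fun r => (∑ i, if θ i = 0 ∧ r i = true then (1 : ℝ) else 0) /
    max 1 (∑ i, if r i = true then (1 : ℝ) else 0)

theorem measurable_FNP {n : ℕ} (θ : Fin n → ℝ) (φ : Procedure n) : Measurable (FNP θ φ) := by
  have h : ∀ f : (Fin n → Bool) → ℝ, Measurable fun x => f (φ.reject x) := fun f =>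
    (measurable_of_finite f).comp φ.measurable_reject
  exact h fun r => (∑ i, if θ i ≠ 0 ∧ r i = false then (1 : ℝ) else 0) /
    max 1 (∑ i, if θ i ≠ 0 then (1 : ℝ) else 0)

theorem FDP_mem_Icc {n : ℕ} (θ : Fin n → ℝ) (φ : Procedure n) (x : Fin n → ℝ) :
    FDP θ φ x ∈ Set.Icc (0 : ℝ) 1 := by
  have h : (∑ i, if θ i = 0 ∧ φ.reject x i = true then (1 : ℝ) else 0) ≤
      ∑ i, if φ.reject x i = true then (1 : ℝ) else 0 :=
    Finset.sum_le_sum fun i _ => by split_ifs <;> simp_all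
  refine ⟨div_nonneg (Finset.sum_nonneg fun i _ => by split_ifs <;> simp) (by positivity), ?_⟩
  exact div_le_one_of_le₀ (h.trans (le_max_right _ _)) (by positivity)

theorem FNP_mem_Icc {n : ℕ} (θ : Fin n → ℝ) (φ : Procedure n) (x : Fin n → ℝ) :
    FNP θ φ x ∈ Set.Icc (0 : ℝ) 1 := by
  have h : (∑ i, if θ i ≠ 0 ∧ φ.reject x i = false then (1 : ℝ) else 0) ≤
      ∑ i, if θ i ≠ 0 then (1 : ℝ) else 0 :=
    Finset.sum_le_sum fun i _ => by split_ifs <;> simp_all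
  refine ⟨div_nonneg (Finset.sum_nonneg fun i _ => by split_ifs <;> simp) (by positivity), ?_⟩
  exact div_le_one_of_le₀ (h.trans (le_max_right _ _)) (by positivity)

theorem integrable_FDP {n : ℕ} (θ : Fin n → ℝ) (φ : Procedure n) :
    Integrable (FDP θ φ) (dataLaw θ) :=
  Integrable.of_mem_Icc 0 1 (measurable_FDP θ φ).aemeasurable
    (ae_of_all _ (FDP_mem_Icc θ φ))

theorem integrable_FNP {n : ℕ} (θ : Fin n → ℝ) (φ : Procedure n) :
    Integrable (FNP θ φ) (dataLaw θ) :=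
  Integrable.of_mem_Icc 0 1 (measurable_FNP θ φ).aemeasurable
    (ae_of_all _ (FNP_mem_Icc θ φ))

theorem risk_mem_Icc {n : ℕ} (θ : Fin n → ℝ) (φ : Procedure n) :
    risk θ φ ∈ Set.Icc (0 : ℝ) 2 := by
  have h1 : FDR θ φ ≤ ∫ _, (1 : ℝ) ∂dataLaw θ :=
    integral_mono (integrable_FDP θ φ) (integrable_const _) fun x => (FDP_mem_Icc θ φ x).2
  have h2 : FNR θ φ ≤ ∫ _, (1 : ℝ) ∂dataLaw θ :=
    integral_mono (integrable_FNP θ φ) (integrable_const _) fun x => (FNP_mem_Icc θ φ x).2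
  have h3 : 0 ≤ FDR θ φ := integral_nonneg fun x => (FDP_mem_Icc θ φ x).1
  have h4 : 0 ≤ FNR θ φ := integral_nonneg fun x => (FNP_mem_Icc θ φ x).1
  simp only [integral_const, probReal_univ, smul_eq_mul, mul_one] at h1 h2
  exact ⟨add_nonneg h3 h4, by unfold risk; linarith⟩

end

end MultipleTesting

/-! Write t for the oracle threshold, a = t + b and p = `gaussTail b`. Note that exp(t²/2) = n/s.

Lower bound (`le_minimaxRisk`). A procedure with more than K·s rejections has FDP at least 1 - 1/K,
since at most s of them are correct. So it suffices to bound the true discoveries of procedures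
making at most K·s rejections (`le_risk`). Put the signal a on a support of size s and average over
supports. Removing a signal coordinate i from the support costs the likelihood ratio L(x_i). Compare
L(x_i) with the sum of L(x_j) over null j: by a law of large numbers this sum is at least of order
n·p, while L(x_i) ≤ δ·n/s unless x_i exceeds a level τ = t + O(1/a). Below τ, coordinate i therefore
looks like many null coordinates, and a budget of K·s rejections detects only an O(δK) fraction of
the signals (`integral_le_of_not_mem`, `sum_integral_insert_le`). Above τ, the signal is seen with
probability `gaussTail (τ - a)`, which tends to 1 - p. Hence the risk is at least p - o(1).

Upper bound (`supRisk_oracle_le`). Each signal is missed by the oracle threshold with probability at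
most p, the expected number of false rejections is at most 2s/t = o(s), and the number of true
rejections is of order s, so FDR = o(1).

Sequences b_n → ±∞ follow from fixed b, because the class shrinks as b grows. -/

namespace MultipleTesting

/-! ### Gaussian tails. -/

theorem gaussTail_eq_real_Ioi (x : ℝ) : gaussTail x = (gaussianReal 0 1).real (Set.Ioi x) := by
  rw [gaussTail, cdf_eq_real, ← probReal_compl_eq_one_sub measurableSet_Iic, Set.compl_Iic]

theorem gaussianReal_real_Ioi (m x : ℝ) :
    (gaussianReal m 1).real (Set.Ioi x) = gaussTail (x - m) := by
  have h := gaussianReal_map_const_add (μ := 0) (v := 1) m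
  rw [zero_add] at h
  rw [gaussTail_eq_real_Ioi, ← h, map_measureReal_apply (by fun_prop) measurableSet_Ioi]
  congr 1
  ext y
  simp [sub_lt_iff_lt_add']

theorem gaussianReal_real_Ici (m x : ℝ) :
    (gaussianReal m 1).real (Set.Ici x) = gaussTail (x - m) := by
  have := nullSingletonClass_gaussianReal (μ := m) (v := 1) one_ne_zero
  rw [← gaussianReal_real_Ioi]
  exact measureReal_congr Ioi_ae_eq_Ici.symm

theorem gaussianReal_real_Iic (m x : ℝ) :
    (gaussianReal m 1).real (Set.Iic x) = gaussTail (m - x) := by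
  have h := gaussianReal_map_neg (μ := -m) (v := 1)
  rw [neg_neg] at h
  rw [← h, map_measureReal_apply (by fun_prop) measurableSet_Iic]
  have : (fun y : ℝ => -y) ⁻¹' Set.Iic x = Set.Ici (-x) := by
    ext y; simp
  rw [this, gaussianReal_real_Ici]
  ring_nf

theorem gaussTail_neg (x : ℝ) : gaussTail (-x) = 1 - gaussTail x := by
  have := gaussianReal_real_Iic 0 x
  rw [zero_sub] at this
  rw [← this, gaussTail_eq_real_Ioi, ← probReal_compl_eq_one_sub measurableSet_Ioi, Set.compl_Ioi]

theorem gaussTail_nonneg (x : ℝ) : 0 ≤ gaussTail x := by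
  rw [gaussTail_eq_real_Ioi]; exact measureReal_nonneg

theorem gaussTail_le_one (x : ℝ) : gaussTail x ≤ 1 := by
  rw [gaussTail_eq_real_Ioi]; exact measureReal_le_one

theorem antitone_gaussTail : Antitone gaussTail := fun _ _ h =>
  sub_le_sub_left (monotone_cdf _ h) 1

theorem tendsto_gaussTail_atTop : Tendsto gaussTail atTop (𝓝 0) := by
  have h := (tendsto_cdf_atTop (gaussianReal 0 1)).const_sub 1
  rwa [sub_self] at h

theorem tendsto_gaussTail_atBot : Tendsto gaussTail atBot (𝓝 1) := by
  have h := (tendsto_cdf_atBot (gaussianReal 0 1)).const_sub 1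
  rwa [sub_zero] at h

theorem gaussTail_eq_integral (x : ℝ) :
    gaussTail x = ∫ y in Set.Ioi x, gaussianPDFReal 0 1 y := by
  rw [gaussTail_eq_real_Ioi, measureReal_def, gaussianReal_apply_eq_integral _ one_ne_zero,
    ENNReal.toReal_ofReal]
  exact setIntegral_nonneg measurableSet_Ioi fun y _ => gaussianPDFReal_nonneg _ _ _

theorem strictAnti_gaussTail : StrictAnti gaussTail := by
  intro x y hxy
  have hd : gaussTail x = (gaussianReal 0 1).real (Set.Ioc x y) + gaussTail y := by
    rw [gaussTail_eq_real_Ioi, gaussTail_eq_real_Ioi, ← Set.Ioc_union_Ioi_eq_Ioi hxy.le]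
    exact measureReal_union (Set.Ioc_disjoint_Ioi le_rfl) measurableSet_Ioi
  have hpos : 0 < (gaussianReal 0 1).real (Set.Ioc x y) := by
    rw [measureReal_def]
    refine ENNReal.toReal_pos (fun h0 => ?_) (measure_ne_top _ _)
    have := gaussianReal_absolutelyContinuous' 0 (v := 1) one_ne_zero h0
    rw [Real.volume_Ioc, ENNReal.ofReal_eq_zero] at this
    linarith
  linarith

theorem gaussTail_pos (x : ℝ) : 0 < gaussTail x :=
  (gaussTail_nonneg _).trans_lt (strictAnti_gaussTail (lt_add_one x))

theorem continuous_gaussTail : Continuous gaussTail := by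
  have := nullSingletonClass_gaussianReal (μ := 0) (v := 1) one_ne_zero
  refine continuous_const.sub (continuous_iff_continuousAt.2 fun x => ?_)
  rw [(monotone_cdf _).continuousAt_iff_leftLim_eq_rightLim, StieltjesFunction.rightLim_eq]
  have h : (cdf (gaussianReal 0 1)).measure {x} = 0 := by
    rw [measure_cdf]; exact measure_singleton x
  rw [StieltjesFunction.measure_singleton, ENNReal.ofReal_eq_zero] at h
  exact le_antisymm ((monotone_cdf _).leftLim_le le_rfl) (by linarith)

/-- On y > x the factor y/x ≥ 1 turns the integrand into an exact derivative; the normalising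
constant of the density is bounded by 1. The gain 1/x is what makes the false discoveries of the
oracle negligible against s. -/
theorem gaussTail_le_exp_div {x : ℝ} (hx : 0 < x) :
    gaussTail x ≤ Real.exp (-(x ^ 2 / 2)) / x := by
  have hpdf : ∀ y, gaussianPDFReal 0 1 y ≤ Real.exp (-(y ^ 2 / 2)) := fun y => by
    have h1 : (1 : ℝ) ≤ √(2 * Real.pi * (1 : NNReal)) := by
      rw [Real.one_le_sqrt]
      push_cast
      nlinarith [Real.pi_gt_three]
    have h2 : (√(2 * Real.pi * (1 : NNReal)))⁻¹ ≤ 1 := inv_le_one_of_one_le₀ h1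
    have h3 : gaussianPDFReal 0 1 y
        = (√(2 * Real.pi * (1 : NNReal)))⁻¹ * Real.exp (-(y ^ 2 / 2)) := by
      simp [gaussianPDFReal, neg_div]
    rw [h3]
    exact mul_le_of_le_one_left (Real.exp_pos _).le h2
  have hderiv : ∀ y ∈ Set.Ici x, HasDerivAt (fun y : ℝ => -(Real.exp (-(y ^ 2 / 2)) / x))
      (y / x * Real.exp (-(y ^ 2 / 2))) y := fun y _ => by
    have h := ((((hasDerivAt_pow 2 y).div_const 2).neg.exp).div_const x).neg
    convert! h using 1
    simp only [Pi.neg_apply]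
    push_cast
    ring
  have hlim : Tendsto (fun y : ℝ => -(Real.exp (-(y ^ 2 / 2)) / x)) atTop (𝓝 0) := by
    have h : Tendsto (fun y : ℝ => -(y ^ 2 / 2)) atTop atBot :=
      tendsto_neg_atTop_atBot.comp
        ((tendsto_pow_atTop (two_ne_zero)).atTop_div_const (by norm_num))
    simpa using ((Real.tendsto_exp_atBot.comp h).div_const x).neg
  have hnn : ∀ y ∈ Set.Ioi x, 0 ≤ y / x * Real.exp (-(y ^ 2 / 2)) := fun y hy =>
    mul_nonneg (div_nonneg (hx.le.trans (le_of_lt hy)) hx.le) (Real.exp_pos _).le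
  have hint := integrableOn_Ioi_deriv_of_nonneg' hderiv hnn hlim
  have hval := integral_Ioi_of_hasDerivAt_of_nonneg' hderiv hnn hlim
  rw [zero_sub, neg_neg] at hval
  rw [gaussTail_eq_integral, ← hval]
  refine setIntegral_mono_on (integrable_gaussianPDFReal _ _).integrableOn hint measurableSet_Ioi
    fun y hy => (hpdf y).trans ?_
  exact le_mul_of_one_le_left (Real.exp_pos _).le ((one_le_div hx).2 (le_of_lt hy))

/-! ### Likelihood ratios and adding one spike. -/

/-- The likelihood ratio of `N(a, 1)` against `N(0, 1)`. -/
noncomputable def likelihoodRatio (a x : ℝ) : ℝ := Real.exp (a * x - a ^ 2 / 2)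

theorem likelihoodRatio_pos (a x : ℝ) : 0 < likelihoodRatio a x := Real.exp_pos _

@[fun_prop]
theorem measurable_likelihoodRatio (a : ℝ) : Measurable (likelihoodRatio a) := by
  unfold likelihoodRatio; fun_prop

theorem gaussianReal_eq_withDensity_likelihoodRatio (a : ℝ) :
    gaussianReal a 1 =
      (gaussianReal 0 1).withDensity fun x => ENNReal.ofReal (likelihoodRatio a x) := by
  rw [gaussianReal_of_var_ne_zero _ one_ne_zero, gaussianReal_of_var_ne_zero _ one_ne_zero,
    ← withDensity_mul _ (measurable_gaussianPDF _ _) (by fun_prop)]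
  congr 1
  ext x
  rw [Pi.mul_apply, gaussianPDF, gaussianPDF, ← ENNReal.ofReal_mul (gaussianPDFReal_nonneg _ _ _)]
  simp only [gaussianPDFReal, likelihoodRatio, mul_assoc, ← Real.exp_add]
  congr 4
  push_cast
  ring

/-- The vector equal to `a` on `S` and to `0` elsewhere. -/
def spike {n : ℕ} (S : Finset (Fin n)) (a : ℝ) : Fin n → ℝ := fun i => if i ∈ S then a else 0

theorem support_spike {n : ℕ} (S : Finset (Fin n)) {a : ℝ} (ha : a ≠ 0) :
    support (spike S a) = S := by
  ext i; simp [support, spike, ha]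

theorem dataLaw_real_eval {n : ℕ} (θ : Fin n → ℝ) (i : Fin n) {s : Set ℝ} (hs : MeasurableSet s) :
    (dataLaw θ).real {x | x i ∈ s} = (gaussianReal (θ i) 1).real s :=
  (measurePreserving_eval (fun i => gaussianReal (θ i) 1) i).measureReal_preimage
    hs.nullMeasurableSet

/-- A product measure is determined on boxes. There the indicator times the density factorises over
coordinates, and only the factor at `i` differs from that of the old law. -/
theorem dataLaw_spike_insert {n : ℕ} {S : Finset (Fin n)} {i : Fin n} (hi : i ∉ S) (a : ℝ) :
    dataLaw (spike (insert i S) a) =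
      (dataLaw (spike S a)).withDensity fun x => ENNReal.ofReal (likelihoodRatio a (x i)) := by
  refine Measure.pi_eq fun s hs => ?_
  set F : Fin n → ℝ → ENNReal := fun j x =>
    (s j).indicator (fun y => if j = i then ENNReal.ofReal (likelihoodRatio a y) else 1) x
  have hF : ∀ j, Measurable (F j) := fun j => by
    refine Measurable.indicator ?_ (hs j)
    split_ifs <;> fun_prop
  have hprod : ∀ x : Fin n → ℝ, (Set.univ.pi s).indicator
      (fun x => ENNReal.ofReal (likelihoodRatio a (x i))) x = ∏ j, F j (x j) := fun x => by
    by_cases hx : x ∈ Set.univ.pi s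
    · rw [Set.indicator_of_mem hx, Finset.prod_eq_single i]
      · simp [F, hx i (Set.mem_univ _)]
      · intro j _ hj; simp [F, hx j (Set.mem_univ _), hj]
      · simp
    · rw [Set.indicator_of_notMem hx]
      obtain ⟨j, hj⟩ : ∃ j, x j ∉ s j := by simpa [Set.mem_pi] using hx
      exact (Finset.prod_eq_zero (Finset.mem_univ j) (by simp [F, hj])).symm
  have hind : iIndepFun (fun j (x : Fin n → ℝ) => F j (x j)) (dataLaw (spike S a)) :=
    iIndepFun_pi fun j => (hF j).aemeasurable
  rw [withDensity_apply _ (MeasurableSet.univ_pi hs),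
    ← lintegral_indicator (MeasurableSet.univ_pi hs)]
  simp_rw [hprod]
  rw [lintegral_prod_eq_prod_lintegral_of_indepFun _ _ hind fun j => by fun_prop]
  refine Finset.prod_congr rfl fun j _ => ?_
  have hj := (measurePreserving_eval (fun i => gaussianReal (spike S a i) 1) j).lintegral_comp (hF j)
  refine hj.trans ?_
  rw [lintegral_indicator (hs j)]
  by_cases hj : j = i
  · subst hj
    simp only [spike, hi, Finset.mem_insert_self, if_true, if_false]
    rw [gaussianReal_eq_withDensity_likelihoodRatio a, withDensity_apply _ (hs j)]
  · simp [spike, hj]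

theorem integral_spike_insert {n : ℕ} {S : Finset (Fin n)} {i : Fin n} (hi : i ∉ S) (a : ℝ)
    (g : (Fin n → ℝ) → ℝ) :
    ∫ x, g x ∂dataLaw (spike (insert i S) a) =
      ∫ x, likelihoodRatio a (x i) * g x ∂dataLaw (spike S a) := by
  rw [dataLaw_spike_insert hi, integral_withDensity_eq_integral_toReal_smul (by fun_prop)
    (ae_of_all _ fun _ => ENNReal.ofReal_lt_top)]
  simp [ENNReal.toReal_ofReal (likelihoodRatio_pos _ _).le]

theorem integrable_likelihoodRatio_mul {n : ℕ} {S : Finset (Fin n)} {i : Fin n} (hi : i ∉ S)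
    {a : ℝ} {g : (Fin n → ℝ) → ℝ} (hg : Integrable g (dataLaw (spike (insert i S) a))) :
    Integrable (fun x => likelihoodRatio a (x i) * g x) (dataLaw (spike S a)) := by
  rw [dataLaw_spike_insert hi, integrable_withDensity_iff_integrable_smul' (by fun_prop)
    (ae_of_all _ fun _ => ENNReal.ofReal_lt_top)] at hg
  simpa [ENNReal.toReal_ofReal (likelihoodRatio_pos _ _).le] using hg

/-! ### Chebyshev bounds and truncated likelihood ratios. -/

/-- Chebyshev's inequality, with each variance bounded by a second moment. It serves both bounds:
truncated likelihood ratios of nulls, and detections of signals. -/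
theorem dataLaw_real_sum_le {n : ℕ} (θ : Fin n → ℝ) {X : Fin n → ℝ → ℝ}
    (hX : ∀ j, MemLp (X j) 2 (gaussianReal (θ j) 1)) {w c v : ℝ} (hc : 0 < c)
    (hw : w + c ≤ ∑ j, ∫ x, X j x ∂gaussianReal (θ j) 1)
    (hv : ∑ j, ∫ x, X j x ^ 2 ∂gaussianReal (θ j) 1 ≤ v) :
    (dataLaw θ).real {x | ∑ j, X j (x j) < w} ≤ v / c ^ 2 := by
  have hmem : ∀ j, MemLp (fun x : Fin n → ℝ => X j (x j)) 2 (dataLaw θ) := fun j =>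
    (hX j).comp_measurePreserving (measurePreserving_eval (fun i => gaussianReal (θ i) 1) j)
  have hsum : MemLp (∑ j, fun x : Fin n → ℝ => X j (x j)) 2 (dataLaw θ) :=
    memLp_finsetSum' _ fun j _ => hmem j
  have hmean : ∫ x, (∑ j, fun x : Fin n → ℝ => X j (x j)) x ∂dataLaw θ =
      ∑ j, ∫ x, X j x ∂gaussianReal (θ j) 1 := by
    simp only [Finset.sum_apply]
    rw [integral_finsetSum _ fun j _ => (hmem j).integrable one_le_two]
    exact Finset.sum_congr rfl fun j _ =>
      integral_comp_eval (μ := fun i => gaussianReal (θ i) 1) (hX j).aestronglyMeasurable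
  have hvar : Var[∑ j, fun x : Fin n → ℝ => X j (x j); dataLaw θ] ≤ v := by
    refine le_trans ?_ hv
    rw [dataLaw, variance_sum_pi hX]
    exact Finset.sum_le_sum fun j _ =>
      variance_le_expectation_sq (hX j).aestronglyMeasurable
  have hcheb := meas_ge_le_variance_div_sq hsum hc
  have hnn : 0 ≤ Var[∑ j, fun x : Fin n → ℝ => X j (x j); dataLaw θ] / c ^ 2 :=
    div_nonneg (variance_nonneg _ _) (sq_nonneg _)
  calc (dataLaw θ).real {x | ∑ j, X j (x j) < w}
      ≤ (dataLaw θ).real {x | c ≤ |(∑ j, fun x : Fin n → ℝ => X j (x j)) x -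
          ∫ x, (∑ j, fun x : Fin n → ℝ => X j (x j)) x ∂dataLaw θ|} := by
        refine measureReal_mono fun x hx => ?_
        simp only [Set.mem_ofPred_eq] at hx ⊢
        rw [hmean, Finset.sum_apply]
        exact le_trans (by linarith) (neg_le_abs _)
    _ ≤ Var[∑ j, fun x : Fin n → ℝ => X j (x j); dataLaw θ] / c ^ 2 :=
        ENNReal.toReal_le_of_le_ofReal hnn hcheb
    _ ≤ v / c ^ 2 := by gcongr

/-- The likelihood ratio truncated above the level `t` of the observation. -/
noncomputable def truncatedLR (a t x : ℝ) : ℝ := (Set.Iic t).indicator (likelihoodRatio a) x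

@[fun_prop]
theorem measurable_truncatedLR (a t : ℝ) : Measurable (truncatedLR a t) :=
  (measurable_likelihoodRatio a).indicator measurableSet_Iic

theorem truncatedLR_nonneg (a t x : ℝ) : 0 ≤ truncatedLR a t x :=
  Set.indicator_nonneg (fun _ _ => (likelihoodRatio_pos _ _).le) _

theorem truncatedLR_le (a t x : ℝ) : truncatedLR a t x ≤ likelihoodRatio a x :=
  Set.indicator_le_self' (fun _ _ => (likelihoodRatio_pos _ _).le) _

theorem likelihoodRatio_mono {a : ℝ} (ha : 0 ≤ a) : Monotone (likelihoodRatio a) := fun x y h => by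
  unfold likelihoodRatio; gcongr

theorem truncatedLR_le_const {a : ℝ} (ha : 0 ≤ a) (t x : ℝ) :
    truncatedLR a t x ≤ likelihoodRatio a t :=
  Set.indicator_le' (fun _ hx => likelihoodRatio_mono ha hx)
    (fun _ _ => (likelihoodRatio_pos _ _).le) x

theorem memLp_truncatedLR {a : ℝ} (ha : 0 ≤ a) (t : ℝ) (p : ENNReal) (μ : Measure ℝ)
    [IsFiniteMeasure μ] : MemLp (truncatedLR a t) p μ := by
  refine MemLp.of_bound (measurable_truncatedLR a t).aestronglyMeasurable (likelihoodRatio a t)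
    (ae_of_all _ fun x => ?_)
  rw [Real.norm_of_nonneg (truncatedLR_nonneg _ _ _)]
  exact truncatedLR_le_const ha t x

theorem integral_truncatedLR (a t : ℝ) :
    ∫ x, truncatedLR a t x ∂gaussianReal 0 1 = gaussTail (a - t) := by
  have h : ∀ x, truncatedLR a t x =
      likelihoodRatio a x * (Set.Iic t).indicator (fun _ => 1) x := fun x => by
    simp [truncatedLR, Set.indicator_apply]
  rw [← gaussianReal_real_Iic, ← integral_indicator_one measurableSet_Iic,
    gaussianReal_eq_withDensity_likelihoodRatio a,
    integral_withDensity_eq_integral_toReal_smul (by fun_prop)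
      (ae_of_all _ fun _ => ENNReal.ofReal_lt_top)]
  simp_rw [h, ENNReal.toReal_ofReal (likelihoodRatio_pos _ _).le, smul_eq_mul]
  rfl

/-- Truncation caps one of the two factors at its value at `t`. Without it the second moment is
exp(a²), of order (n/s)² at b = 0, which is too large for Chebyshev when s is small. -/
theorem integral_truncatedLR_sq_le {a : ℝ} (ha : 0 ≤ a) (t : ℝ) :
    ∫ x, truncatedLR a t x ^ 2 ∂gaussianReal 0 1 ≤ likelihoodRatio a t := by
  have h : ∀ x, truncatedLR a t x ^ 2 ≤ likelihoodRatio a t * truncatedLR a t x := fun x => by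
    rw [sq]
    exact mul_le_mul_of_nonneg_right (truncatedLR_le_const ha t x) (truncatedLR_nonneg _ _ _)
  calc ∫ x, truncatedLR a t x ^ 2 ∂gaussianReal 0 1
      ≤ ∫ x, likelihoodRatio a t * truncatedLR a t x ∂gaussianReal 0 1 :=
        integral_mono (memLp_truncatedLR ha t 2 _).integrable_sq
          ((memLp_truncatedLR ha t 1 _).integrable le_rfl |>.const_mul _) h
    _ = likelihoodRatio a t * gaussTail (a - t) := by
        rw [integral_const_mul, integral_truncatedLR]
    _ ≤ likelihoodRatio a t :=
        mul_le_of_le_one_right (likelihoodRatio_pos _ _).le (gaussTail_le_one _)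

/-- The truncated likelihood ratios of the null coordinates concentrate. -/
theorem dataLaw_real_sum_truncatedLR_lt {n : ℕ} {S : Finset (Fin n)} {a : ℝ} (ha : 0 ≤ a) (t : ℝ)
    {w c : ℝ} (hc : 0 < c) (hw : w + c ≤ (Sᶜ.card : ℝ) * gaussTail (a - t)) :
    (dataLaw (spike S a)).real {x | ∑ j ∈ Sᶜ, truncatedLR a t (x j) < w} ≤
      Sᶜ.card * likelihoodRatio a t / c ^ 2 := by
  have h := dataLaw_real_sum_le (spike S a)
    -- Signal coordinates contribute zero, so the bound over all coordinates applies to the nulls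
    -- alone.
    (X := fun j => if j ∈ Sᶜ then truncatedLR a t else 0) (w := w) (c := c)
    (v := Sᶜ.card * likelihoodRatio a t)
    (fun j => by split_ifs; exacts [memLp_truncatedLR ha t _ _, MemLp.zero]) hc ?_ ?_
  · refine le_trans (le_of_eq ?_) h
    congr 1
    ext x
    simp only [Set.mem_ofPred_eq, ite_apply, Pi.zero_apply, ← Finset.sum_filter]
    rw [Finset.filter_mem_eq_inter, Finset.univ_inter]
  · refine hw.trans (le_of_eq ?_)
    rw [← Finset.sum_subset (Finset.subset_univ Sᶜ) fun j _ hj => by simp [hj],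
      ← nsmul_eq_mul, ← Finset.sum_const]
    refine Finset.sum_congr rfl fun j hj => ?_
    have hj' := Finset.mem_compl.1 hj
    simp [spike, hj', integral_truncatedLR]
  · rw [← Finset.sum_subset (Finset.subset_univ Sᶜ) fun j _ hj => by simp [hj],
      ← nsmul_eq_mul, ← Finset.sum_const]
    refine Finset.sum_le_sum fun j hj => ?_
    have hj' := Finset.mem_compl.1 hj
    simpa [spike, hj'] using integral_truncatedLR_sq_le ha t

/-! ### Comparing a signal coordinate with the null coordinates. -/

/-- Discard the events x_i > τ and "the null sum is below w". On the rest, L(x_i) ≤ L(τ) ≤ (L(τ)/w)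
∑ L(x_j); after integrating against the law with support `S`, each L(x_j) on the right moves the
spike to `j`. -/
theorem integral_le_of_not_mem {n : ℕ} {S : Finset (Fin n)} {i : Fin n} (hi : i ∉ S) {a : ℝ}
    (ha : 0 ≤ a) (t τ : ℝ) {w : ℝ} (hw : 0 < w) {f : (Fin n → ℝ) → ℝ} (hf : Measurable f)
    (hf01 : ∀ x, f x ∈ Set.Icc (0 : ℝ) 1) :
    ∫ x, f x ∂dataLaw (spike (insert i S) a) ≤
      gaussTail (τ - a) +
      (dataLaw (spike (insert i S) a)).real {x | ∑ j ∈ (insert i S)ᶜ, truncatedLR a t (x j) < w} +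
      likelihoodRatio a τ / w * ∑ j ∈ Sᶜ, ∫ x, f x ∂dataLaw (spike (insert j S) a) := by
  set P := dataLaw (spike (insert i S) a)
  set A : Set (Fin n → ℝ) := {x | x i ∈ Set.Ioi τ}
  set B : Set (Fin n → ℝ) := {x | ∑ j ∈ (insert i S)ᶜ, truncatedLR a t (x j) < w}
  have hA : MeasurableSet A := measurable_pi_apply i measurableSet_Ioi
  have hB : MeasurableSet B := measurableSet_lt (by fun_prop) measurable_const
  have hfint : ∀ (θ : Fin n → ℝ), Integrable f (dataLaw θ) := fun θ =>
    Integrable.of_mem_Icc 0 1 hf.aemeasurable (ae_of_all _ hf01)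
  have hC : MeasurableSet (A ∪ B)ᶜ := (hA.union hB).compl
  set g : (Fin n → ℝ) → ℝ := (A ∪ B)ᶜ.indicator f
  have hgint : ∀ (θ : Fin n → ℝ), Integrable g (dataLaw θ) := fun θ => (hfint θ).indicator hC
  have hsplit : ∫ x, f x ∂P ≤ P.real A + P.real B + ∫ x, g x ∂P := by
    rw [← integral_indicator_one hA, ← integral_indicator_one hB, ← integral_add, ← integral_add]
    · refine integral_mono (hfint _) ?_ fun x => ?_
      · exact (((integrable_const 1).indicator hA).add ((integrable_const 1).indicator hB)).add
          (hgint _)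
      · have h1 := hf01 x
        by_cases hxA : x ∈ A <;> by_cases hxB : x ∈ B <;>
          simp [g, hxA, hxB] <;> linarith [h1.1, h1.2]
    · exact ((integrable_const 1).indicator hA).add ((integrable_const 1).indicator hB)
    · exact hgint _
    · exact (integrable_const 1).indicator hA
    · exact (integrable_const 1).indicator hB
  have hPA : P.real A = gaussTail (τ - a) := by
    rw [dataLaw_real_eval _ _ measurableSet_Ioi, gaussianReal_real_Ioi]
    simp [spike]
  have hpt : ∀ x, likelihoodRatio a (x i) * g x ≤
      likelihoodRatio a τ / w * ∑ j ∈ Sᶜ, likelihoodRatio a (x j) * f x := fun x => by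
    have hsum : 0 ≤ ∑ j ∈ Sᶜ, likelihoodRatio a (x j) * f x :=
      Finset.sum_nonneg fun j _ => mul_nonneg (likelihoodRatio_pos _ _).le (hf01 x).1
    by_cases hx : x ∈ (A ∪ B)ᶜ
    · have hxA : x i ≤ τ := by
        by_contra h; exact hx (Or.inl (lt_of_not_ge h))
      have hxB : w ≤ ∑ j ∈ (insert i S)ᶜ, truncatedLR a t (x j) := by
        by_contra h; exact hx (Or.inr (lt_of_not_ge h))
      -- The event `B` leaves out `i`, which is not null under `P`; restoring it and removing the
      -- truncation only enlarge the sum.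
      have hge : w ≤ ∑ j ∈ Sᶜ, likelihoodRatio a (x j) :=
        hxB.trans <| (Finset.sum_le_sum_of_subset_of_nonneg
          (Finset.compl_subset_compl.2 (Finset.subset_insert _ _))
          fun _ _ _ => truncatedLR_nonneg _ _ _).trans
          (Finset.sum_le_sum fun _ _ => truncatedLR_le _ _ _)
      rw [show g x = f x from Set.indicator_of_mem hx f, ← Finset.sum_mul, ← mul_assoc]
      refine mul_le_mul_of_nonneg_right ?_ (hf01 x).1
      calc likelihoodRatio a (x i) ≤ likelihoodRatio a τ := likelihoodRatio_mono ha hxA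
        _ = likelihoodRatio a τ / w * w := by field_simp
        _ ≤ _ := mul_le_mul_of_nonneg_left hge (div_nonneg (likelihoodRatio_pos _ _).le hw.le)
    · rw [show g x = 0 from Set.indicator_of_notMem hx f, mul_zero]
      exact mul_nonneg (div_nonneg (likelihoodRatio_pos _ _).le hw.le) hsum
  have hg : ∫ x, g x ∂P ≤
      likelihoodRatio a τ / w * ∑ j ∈ Sᶜ, ∫ x, f x ∂dataLaw (spike (insert j S) a) := by
    have hj : ∀ j ∈ Sᶜ, Integrable (fun x => likelihoodRatio a (x j) * f x)
        (dataLaw (spike S a)) := fun j hj =>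
      integrable_likelihoodRatio_mul (Finset.mem_compl.1 hj) (hfint _)
    rw [integral_spike_insert hi, Finset.sum_congr rfl fun j hj =>
      integral_spike_insert (Finset.mem_compl.1 hj) a f, ← integral_finsetSum _ hj,
      ← integral_const_mul]
    exact integral_mono (integrable_likelihoodRatio_mul hi (hgint _))
      ((integrable_finsetSum _ hj).const_mul _) hpt
  rw [← hPA]
  linarith

/-- After exchanging the sums, for each spike position `j` the total of the f_i is at most `M`,
whatever the law. So the comparison term costs `M` for each of the N + 1 positions. -/
theorem sum_integral_insert_le {n : ℕ} (S : Finset (Fin n)) {a : ℝ} (ha : 0 ≤ a) (t τ : ℝ)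
    {w c M N : ℝ} (hw : 0 < w) (hc : 0 < c) (hN : (Sᶜ.card : ℝ) = N + 1)
    (hwc : w + c ≤ N * gaussTail (a - t)) {f : Fin n → (Fin n → ℝ) → ℝ}
    (hf : ∀ i, Measurable (f i)) (hf01 : ∀ i x, f i x ∈ Set.Icc (0 : ℝ) 1)
    (hM : ∀ x, ∑ i, f i x ≤ M) :
    ∑ i ∈ Sᶜ, ∫ x, f i x ∂dataLaw (spike (insert i S) a) ≤
      (N + 1) * (gaussTail (τ - a) + N * likelihoodRatio a t / c ^ 2 +
        likelihoodRatio a τ / w * M) := by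
  have hfint : ∀ i (θ : Fin n → ℝ), Integrable (f i) (dataLaw θ) := fun i θ =>
    Integrable.of_mem_Icc 0 1 (hf i).aemeasurable (ae_of_all _ (hf01 i))
  have hcard : ∀ i ∈ Sᶜ, ((insert i S)ᶜ.card : ℝ) = N := fun i hi => by
    have h1 : (insert i S)ᶜ = Sᶜ.erase i := by ext j; simp
    have h2 := Finset.card_erase_add_one hi
    rw [h1]
    have h3 : (((Sᶜ.erase i).card + 1 : ℕ) : ℝ) = Sᶜ.card := by rw [h2]
    push_cast at h3
    linarith
  have hM' : ∀ j, ∑ i ∈ Sᶜ, ∫ x, f i x ∂dataLaw (spike (insert j S) a) ≤ M := fun j => by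
    rw [← integral_finsetSum _ fun i _ => hfint i _]
    calc ∫ x, ∑ i ∈ Sᶜ, f i x ∂dataLaw (spike (insert j S) a)
        ≤ ∫ _, M ∂dataLaw (spike (insert j S) a) := by
          refine integral_mono (integrable_finsetSum _ fun i _ => hfint i _) (integrable_const _)
            fun x => le_trans ?_ (hM x)
          exact Finset.sum_le_sum_of_subset_of_nonneg (Finset.subset_univ _)
            fun i _ _ => (hf01 i x).1
      _ = M := by simp
  calc ∑ i ∈ Sᶜ, ∫ x, f i x ∂dataLaw (spike (insert i S) a)
      ≤ ∑ i ∈ Sᶜ, (gaussTail (τ - a) + N * likelihoodRatio a t / c ^ 2 +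
          likelihoodRatio a τ / w * ∑ j ∈ Sᶜ, ∫ x, f i x ∂dataLaw (spike (insert j S) a)) := by
        refine Finset.sum_le_sum fun i hi => ?_
        refine (integral_le_of_not_mem (Finset.mem_compl.1 hi) ha t τ hw (hf i) (hf01 i)).trans ?_
        have := dataLaw_real_sum_truncatedLR_lt (S := insert i S) ha t (w := w) hc
          (by rw [hcard i hi]; exact hwc)
        rw [hcard i hi] at this
        gcongr
    _ = (N + 1) * (gaussTail (τ - a) + N * likelihoodRatio a t / c ^ 2) +
          likelihoodRatio a τ / w *
            ∑ j ∈ Sᶜ, ∑ i ∈ Sᶜ, ∫ x, f i x ∂dataLaw (spike (insert j S) a) := by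
        rw [Finset.sum_add_distrib, Finset.sum_const, nsmul_eq_mul, hN, ← Finset.mul_sum,
          Finset.sum_comm]
    _ ≤ (N + 1) * (gaussTail (τ - a) + N * likelihoodRatio a t / c ^ 2) +
          likelihoodRatio a τ / w * ∑ j ∈ Sᶜ, M := by
        have : 0 ≤ likelihoodRatio a τ / w := div_nonneg (likelihoodRatio_pos _ _).le hw.le
        gcongr with j
        exact hM' j
    _ = _ := by
        rw [Finset.sum_const, nsmul_eq_mul, hN]
        ring

/-! ### Averaging over supports. -/

theorem sum_powersetCard_succ_sum {α β : Type*} [Fintype α] [DecidableEq α] [AddCommMonoid β]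
    (k : ℕ) (g : Finset α → α → β) :
    ∑ S ∈ Finset.powersetCard (k + 1) Finset.univ, ∑ i ∈ S, g S i =
      ∑ S ∈ Finset.powersetCard k Finset.univ, ∑ i ∈ Sᶜ, g (insert i S) i := by
  rw [Finset.sum_sigma', Finset.sum_sigma']
  refine Finset.sum_bij' (fun p _ => ⟨p.1.erase p.2, p.2⟩) (fun p _ => ⟨insert p.2 p.1, p.2⟩)
    ?_ ?_ ?_ ?_ ?_
  · rintro ⟨S, i⟩ h
    simp only [Finset.mem_sigma, Finset.mem_powersetCard_univ] at h
    simp [Finset.card_erase_of_mem h.2, h.1]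
  · rintro ⟨S, i⟩ h
    simp only [Finset.mem_sigma, Finset.mem_powersetCard_univ, Finset.mem_compl] at h
    simp [Finset.card_insert_of_notMem h.2, h.1]
  · rintro ⟨S, i⟩ h
    simp only [Finset.mem_sigma] at h
    simp [Finset.insert_erase h.2]
  · rintro ⟨S, i⟩ h
    simp only [Finset.mem_sigma, Finset.mem_compl] at h
    simp [Finset.erase_insert h.2]
  · rintro ⟨S, i⟩ h
    simp only [Finset.mem_sigma] at h
    simp [Finset.insert_erase h.2]

/-- Some support does no worse than the average. Pairs (support, element) are regrouped by the
support with the element removed, and (k+1)·C(n,k+1) = (n-k)·C(n,k) matches the counts. -/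
theorem exists_card_eq_sum_integral_le {n k : ℕ} (hk : k < n) {a : ℝ} (ha : 0 ≤ a) (t τ : ℝ)
    {w c M : ℝ} (hw : 0 < w) (hc : 0 < c)
    (hwc : w + c ≤ ((n : ℝ) - (k + 1)) * gaussTail (a - t)) {f : Fin n → (Fin n → ℝ) → ℝ}
    (hf : ∀ i, Measurable (f i)) (hf01 : ∀ i x, f i x ∈ Set.Icc (0 : ℝ) 1)
    (hM : ∀ x, ∑ i, f i x ≤ M) :
    ∃ S : Finset (Fin n), S.card = k + 1 ∧
      ∑ i ∈ S, ∫ x, f i x ∂dataLaw (spike S a) ≤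
        (k + 1) * (gaussTail (τ - a) + ((n : ℝ) - (k + 1)) * likelihoodRatio a t / c ^ 2 +
          likelihoodRatio a τ / w * M) := by
  set η := gaussTail (τ - a) + ((n : ℝ) - (k + 1)) * likelihoodRatio a t / c ^ 2 +
          likelihoodRatio a τ / w * M
  have hne : (Finset.powersetCard (k + 1) (Finset.univ : Finset (Fin n))).Nonempty :=
    Finset.powersetCard_nonempty.2 (by simpa using hk)
  obtain ⟨S, hS, hle⟩ := Finset.exists_le_of_sum_le hne
    (f := fun S => ∑ i ∈ S, ∫ x, f i x ∂dataLaw (spike S a)) (g := fun _ => (k + 1) * η) (by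
      rw [sum_powersetCard_succ_sum k fun S i => ∫ x, f i x ∂dataLaw (spike S a)]
      calc _ ≤ ∑ S ∈ Finset.powersetCard k (Finset.univ : Finset (Fin n)),
              ((n : ℝ) - k) * η := by
            refine Finset.sum_le_sum fun S hS => ?_
            rw [Finset.mem_powersetCard_univ] at hS
            have hcard : (Sᶜ.card : ℝ) = ((n : ℝ) - (k + 1)) + 1 := by
              rw [Finset.card_compl, hS, Fintype.card_fin, Nat.cast_sub hk.le]
              ring
            have := sum_integral_insert_le S ha t τ hw hc hcard hwc hf hf01 hM
            rwa [show (n : ℝ) - (k + 1) + 1 = n - k by ring] at this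
        _ = _ := by
            rw [Finset.sum_const, Finset.sum_const, Finset.card_powersetCard,
              Finset.card_powersetCard, Finset.card_univ, Fintype.card_fin, nsmul_eq_mul,
              nsmul_eq_mul, ← mul_assoc, ← mul_assoc]
            have h := Nat.choose_succ_right_eq n k
            have h' : (n.choose (k + 1) : ℝ) * (k + 1) = n.choose k * (n - k) := by
              rw [← Nat.cast_sub hk.le]
              exact_mod_cast h
            rw [h'])
  exact ⟨S, Finset.mem_powersetCard_univ.1 hS, hle⟩

/-! ### From the risk to true discoveries under a rejection budget. -/

theorem sum_ite_ne_zero {n : ℕ} (θ : Fin n → ℝ) (f : Fin n → ℝ) :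
    ∑ i ∈ support θ, f i = ∑ i, if θ i ≠ 0 then f i else 0 := by
  rw [support, Finset.sum_filter]

/-- The number of rejections. -/
noncomputable def numReject {n : ℕ} (φ : Procedure n) (x : Fin n → ℝ) : ℝ :=
  ∑ i, if φ.reject x i = true then (1 : ℝ) else 0

/-- The procedure `φ`, modified to reject nothing whenever it makes more than `M` rejections. -/
noncomputable def cappedReject {n : ℕ} (φ : Procedure n) (M : ℝ) (i : Fin n) (x : Fin n → ℝ) : ℝ :=
  if numReject φ x ≤ M then (if φ.reject x i = true then 1 else 0) else 0

theorem measurable_cappedReject {n : ℕ} (φ : Procedure n) (M : ℝ) (i : Fin n) :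
    Measurable (cappedReject φ M i) := by
  have h : ∀ f : (Fin n → Bool) → ℝ, Measurable fun x => f (φ.reject x) := fun f =>
    (measurable_of_finite f).comp φ.measurable_reject
  exact h fun r => if (∑ i, if r i = true then (1 : ℝ) else 0) ≤ M then
    (if r i = true then 1 else 0) else 0

theorem cappedReject_mem_Icc {n : ℕ} (φ : Procedure n) (M : ℝ) (i : Fin n) (x : Fin n → ℝ) :
    cappedReject φ M i x ∈ Set.Icc (0 : ℝ) 1 := by
  unfold cappedReject; split_ifs <;> simp

theorem sum_cappedReject_le {n : ℕ} (φ : Procedure n) {M : ℝ} (hM : 0 ≤ M) (x : Fin n → ℝ) :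
    ∑ i, cappedReject φ M i x ≤ M := by
  by_cases h : numReject φ x ≤ M
  · simp only [cappedReject, h, if_true]; exact h
  · simpa [cappedReject, h] using hM

theorem sum_ite_eq_card_support {n : ℕ} (θ : Fin n → ℝ) :
    (∑ i, if θ i ≠ 0 then (1 : ℝ) else 0) = (support θ).card := by
  rw [← sum_ite_ne_zero]; simp

/-- Within the budget, FNP is exactly one minus the fraction of signals found. Beyond it, at most
`s` of more than K·s rejections are correct, so FDP alone is at least 1 - 1/K. -/
theorem le_FDP_add_FNP {n s : ℕ} (hs : 1 ≤ s) {θ : Fin n → ℝ} (hθ : (support θ).card = s)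
    (φ : Procedure n) {K : ℝ} (hK : 1 ≤ K) (x : Fin n → ℝ) :
    1 - 1 / K - (∑ i ∈ support θ, cappedReject φ (K * s) i x) / s ≤ FDP θ φ x + FNP θ φ x := by
  have hs' : (1 : ℝ) ≤ s := by exact_mod_cast hs
  have hs0 : (0 : ℝ) < s := by linarith
  have hK0 : 0 < 1 / K := by positivity
  by_cases h : numReject φ x ≤ K * s
  -- Hides the `s` inside the budget, so that rewriting `s` as the support size leaves the budget
  -- alone.
  · generalize K * (s : ℝ) = M at h ⊢
    have h1 : FNP θ φ x = 1 - (∑ i ∈ support θ, cappedReject φ M i x) / s := by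
      rw [FNP, sum_ite_eq_card_support, hθ, max_eq_right hs', eq_sub_iff_add_eq, ← add_div,
        div_eq_one_iff_eq hs0.ne', sum_ite_ne_zero, ← Finset.sum_add_distrib, ← hθ,
        ← sum_ite_eq_card_support]
      refine Finset.sum_congr rfl fun i _ => ?_
      by_cases hi : θ i = 0 <;> cases hr : φ.reject x i <;> simp [cappedReject, h, hi, hr]
    have h2 := (FDP_mem_Icc θ φ x).1
    linarith
  · push Not at h
    have hR : s < numReject φ x := lt_of_le_of_lt (by nlinarith) h
    have hV : numReject φ x - s ≤ ∑ i, if θ i = 0 ∧ φ.reject x i = true then (1 : ℝ) else 0 := by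
      rw [sub_le_iff_le_add, ← hθ, ← sum_ite_eq_card_support, ← Finset.sum_add_distrib]
      refine Finset.sum_le_sum fun i _ => ?_
      by_cases hi : θ i = 0 <;> cases hr : φ.reject x i <;> simp [hi]
    have h1 : 1 - 1 / K ≤ FDP θ φ x := by
      have hm : max 1 (∑ i, if φ.reject x i = true then (1 : ℝ) else 0) = numReject φ x :=
        max_eq_right (hs'.trans hR.le)
      rw [FDP, hm, le_div_iff₀ (by linarith)]
      refine le_trans ?_ hV
      have : (s : ℝ) ≤ 1 / K * numReject φ x := by
        rw [div_mul_eq_mul_div, one_mul, le_div_iff₀ (by linarith)]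
        linarith
      linarith
    have h2 := (FNP_mem_Icc θ φ x).1
    have h3 : 0 ≤ (∑ i ∈ support θ, cappedReject φ (K * s) i x) / s :=
      div_nonneg (Finset.sum_nonneg fun i _ => (cappedReject_mem_Icc _ _ _ _).1) hs0.le
    linarith

theorem le_risk {n s : ℕ} (hs : 1 ≤ s) {θ : Fin n → ℝ} (hθ : (support θ).card = s)
    (φ : Procedure n) {K : ℝ} (hK : 1 ≤ K) :
    1 - 1 / K - (∑ i ∈ support θ, ∫ x, cappedReject φ (K * s) i x ∂dataLaw θ) / s ≤ risk θ φ := by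
  have hint : ∀ i ∈ support θ, Integrable (cappedReject φ (K * s) i) (dataLaw θ) := fun i _ =>
    Integrable.of_mem_Icc 0 1 (measurable_cappedReject _ _ _).aemeasurable
      (ae_of_all _ (cappedReject_mem_Icc _ _ _))
  have hdiv := (integrable_finsetSum _ hint).div_const (s : ℝ)
  rw [risk, FDR, FNR, ← integral_add (integrable_FDP θ φ) (integrable_FNP θ φ)]
  refine le_trans (le_of_eq ?_) (integral_mono ((integrable_const (1 - 1 / K)).sub hdiv)
    ((integrable_FDP θ φ).add (integrable_FNP θ φ)) fun x => le_FDP_add_FNP hs hθ φ hK x)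
  simp only [Pi.sub_apply]
  rw [integral_sub (integrable_const _) hdiv, integral_div, integral_finsetSum _ hint]
  simp

/-! ### Order properties of the worst-case and minimax risks. -/

theorem bddAbove_range_risk {n : ℕ} (Θ : Set (Fin n → ℝ)) (φ : Procedure n) :
    BddAbove (Set.range fun θ : Θ => risk θ.1 φ) :=
  ⟨2, by rintro _ ⟨θ, rfl⟩; exact (risk_mem_Icc _ _).2⟩

theorem risk_le_supRisk {n : ℕ} {Θ : Set (Fin n → ℝ)} {θ : Fin n → ℝ} (hθ : θ ∈ Θ)
    (φ : Procedure n) : risk θ φ ≤ supRisk Θ φ :=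
  le_ciSup (bddAbove_range_risk Θ φ) ⟨θ, hθ⟩

theorem supRisk_nonneg {n : ℕ} (Θ : Set (Fin n → ℝ)) (φ : Procedure n) : 0 ≤ supRisk Θ φ :=
  Real.iSup_nonneg fun _ => (risk_mem_Icc _ _).1

theorem minimaxRisk_le_supRisk {n : ℕ} (Θ : Set (Fin n → ℝ)) (φ : Procedure n) :
    minimaxRisk Θ ≤ supRisk Θ φ :=
  ciInf_le ⟨0, by rintro _ ⟨φ, rfl⟩; exact supRisk_nonneg _ _⟩ φ

theorem minimaxRisk_nonneg {n : ℕ} (Θ : Set (Fin n → ℝ)) : 0 ≤ minimaxRisk Θ :=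
  le_ciInf fun _ => supRisk_nonneg _ _

theorem supRisk_mono {n : ℕ} {Θ Θ' : Set (Fin n → ℝ)} (h : Θ ⊆ Θ') (φ : Procedure n) :
    supRisk Θ φ ≤ supRisk Θ' φ :=
  -- Nonnegativity of the bound covers an empty class, where the real supremum is 0.
  Real.iSup_le (fun θ => risk_le_supRisk (h θ.2) φ) (supRisk_nonneg _ _)

theorem minimaxRisk_mono {n : ℕ} {Θ Θ' : Set (Fin n → ℝ)} (h : Θ ⊆ Θ') :
    minimaxRisk Θ ≤ minimaxRisk Θ' :=
  le_ciInf fun φ => (minimaxRisk_le_supRisk Θ φ).trans (supRisk_mono h φ)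

theorem boundaryClass_antitone (n s : ℕ) : Antitone (boundaryClass n s) := fun _ _ h _ hθ =>
  ⟨hθ.1, fun i hi => (add_le_add_right h _).trans (hθ.2 i hi)⟩

/-- The trivial procedure, which rejects nothing, has risk at most `1`. -/
theorem minimaxRisk_le_one {n : ℕ} (Θ : Set (Fin n → ℝ)) : minimaxRisk Θ ≤ 1 := by
  let φ : Procedure n := ⟨fun _ _ => false, measurable_const⟩
  refine (minimaxRisk_le_supRisk Θ φ).trans (Real.iSup_le (fun θ => ?_) zero_le_one)
  have h1 : FDR θ.1 φ = 0 := by simp [FDR, FDP, φ]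
  have h2 : FNR θ.1 φ ≤ ∫ _, (1 : ℝ) ∂dataLaw θ.1 :=
    integral_mono (integrable_FNP _ φ) (integrable_const _) fun x => (FNP_mem_Icc _ φ x).2
  simp only [integral_const, probReal_univ, smul_eq_mul, mul_one] at h2
  rw [risk, h1]
  linarith

/-! ### Non-asymptotic lower bound. -/

theorem oracleThreshold_sq {n s : ℕ} (hs : 1 ≤ s) (hsn : s ≤ n) :
    oracleThreshold n s ^ 2 = 2 * Real.log ((n : ℝ) / s) := by
  have : (1 : ℝ) ≤ (n : ℝ) / s := by
    rw [one_le_div (by exact_mod_cast hs)]; exact_mod_cast hsn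
  exact Real.sq_sqrt (mul_nonneg zero_le_two (Real.log_nonneg this))

theorem exp_oracleThreshold_sq {n s : ℕ} (hs : 1 ≤ s) (hsn : s ≤ n) :
    Real.exp (oracleThreshold n s ^ 2 / 2) = n / s := by
  rw [oracleThreshold_sq hs hsn, mul_div_cancel_left₀ _ two_ne_zero, Real.exp_log]
  have h1 : (0 : ℝ) < s := by exact_mod_cast hs
  have h2 : (0 : ℝ) < n := by exact_mod_cast hs.trans hsn
  positivity

theorem le_minimaxRisk {n s : ℕ} (hs : 1 ≤ s) (hsn : 2 * s ≤ n) {b : ℝ}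
    (ha : 0 < oracleThreshold n s + b) {K δ : ℝ} (hK : 1 ≤ K) (hδ : 0 < δ) :
    1 - 1 / K - (gaussTail (-b + (b ^ 2 / 2 + Real.log δ) / (oracleThreshold n s + b)) +
      8 / (s * gaussTail b ^ 2) + 4 * δ * K / gaussTail b) ≤
        minimaxRisk (boundaryClass n s b) := by
  set t := oracleThreshold n s
  set a := t + b
  set p := gaussTail b
  have hp : 0 < p := gaussTail_pos b
  have hsR : (0 : ℝ) < s := by exact_mod_cast hs
  have hsnR : 2 * (s : ℝ) ≤ n := by exact_mod_cast hsn
  have hNR : (n : ℝ) / 2 ≤ n - s := by linarith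
  have hN0 : (0 : ℝ) < n - s := by linarith
  have hn0 : (0 : ℝ) < n := by linarith
  have hexp : Real.exp (t ^ 2 / 2) = n / s := exp_oracleThreshold_sq hs (by omega)
  -- The solution of aτ - a²/2 = log δ + t²/2, that is, L(τ) = δ·n/s.
  set τ := t + (b ^ 2 / 2 + Real.log δ) / a
  -- The exponent is t²/2 - b²/2.
  have hLt : likelihoodRatio a t ≤ n / s := by
    rw [← hexp, likelihoodRatio]
    refine Real.exp_le_exp.2 ?_
    simp only [a]
    nlinarith [sq_nonneg b]
  have hLτ : likelihoodRatio a τ = δ * (n / s) := by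
    rw [← hexp, likelihoodRatio]
    have : a * τ = a * t + (b ^ 2 / 2 + Real.log δ) := by
      simp only [τ]; field_simp
    have h2 : a * τ - a ^ 2 / 2 = Real.log δ + t ^ 2 / 2 := by
      rw [this]
      simp only [a]
      ring
    rw [h2, Real.exp_add, Real.exp_log hδ]
  obtain ⟨k, rfl⟩ : ∃ k, s = k + 1 := ⟨s - 1, by omega⟩
  refine le_ciInf fun φ => ?_
  have hw : 0 < ((n : ℝ) - (k + 1 : ℕ)) * p / 2 := by positivity
  -- Both `w` and `c` are half the mean (n - s)·p of the null sum.
  obtain ⟨S, hS, hle⟩ := exists_card_eq_sum_integral_le (n := n) (k := k) (by omega) ha.le t τ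
    (f := cappedReject φ (K * (k + 1 : ℕ))) (M := K * (k + 1 : ℕ)) hw hw
    (by
      rw [show a - t = b by simp only [a]; ring]
      push_cast
      exact le_of_eq (by ring))
    (measurable_cappedReject _ _) (cappedReject_mem_Icc _ _)
    (sum_cappedReject_le _ (by positivity))
  have hsupp : support (spike S a) = S := support_spike S ha.ne'
  have hmem : spike S a ∈ boundaryClass n (k + 1) b := by
    refine ⟨by rw [hsupp, hS], fun i hi => ?_⟩
    rw [hsupp] at hi
    simp only [spike, hi, if_true]
    exact le_abs_self a
  refine le_trans ?_ (risk_le_supRisk hmem φ)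
  refine le_trans ?_ (le_risk hs hmem.1 φ hK)
  rw [hsupp]
  refine sub_le_sub_left ?_ _
  rw [div_le_iff₀ hsR]
  push_cast at hle hN0 hNR hsR hsnR hLt hLτ ⊢
  refine hle.trans ((mul_le_mul_of_nonneg_left ?_ hsR.le).trans_eq (mul_comm _ _))
  rw [show τ - a = -b + (b ^ 2 / 2 + Real.log δ) / a by simp only [τ, a]; ring]
  have h2 : ((n : ℝ) - (k + 1)) * likelihoodRatio a t / (((n : ℝ) - (k + 1)) * p / 2) ^ 2 ≤
      8 / ((k + 1) * p ^ 2) := by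
    calc _ ≤ ((n : ℝ) - (k + 1)) * (n / (k + 1)) / (((n : ℝ) - (k + 1)) * p / 2) ^ 2 := by
          gcongr
      _ = n / (n - (k + 1)) * (4 / ((k + 1) * p ^ 2)) := by
          field_simp
          norm_num
      _ ≤ 2 * (4 / ((k + 1) * p ^ 2)) := by
          gcongr
          rw [div_le_iff₀ hN0]; linarith
      _ = _ := by ring
  have h3 : likelihoodRatio a τ / (((n : ℝ) - (k + 1)) * p / 2) * (K * (k + 1)) ≤
      4 * δ * K / p := by
    rw [hLτ]
    calc _ = n / (n - (k + 1)) * (2 * δ * K / p) := by field_simp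
      _ ≤ 2 * (2 * δ * K / p) := by
          gcongr
          rw [div_le_iff₀ hN0]; linarith
      _ = _ := by ring
  linarith

/-! ### Risk of the oracle procedure. -/

theorem gaussianReal_real_abs_lt_le {μ t b : ℝ} (h : t + b ≤ |μ|) :
    (gaussianReal μ 1).real {x | |x| < t} ≤ gaussTail b := by
  rcases le_total 0 μ with hμ | hμ
  · rw [abs_of_nonneg hμ] at h
    calc _ ≤ (gaussianReal μ 1).real (Set.Iic t) :=
          measureReal_mono fun x (hx : |x| < t) => ((le_abs_self x).trans_lt hx).le
      _ = gaussTail (μ - t) := gaussianReal_real_Iic μ t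
      _ ≤ gaussTail b := antitone_gaussTail (by linarith)
  · rw [abs_of_nonpos hμ] at h
    calc _ ≤ (gaussianReal μ 1).real (Set.Ici (-t)) :=
          measureReal_mono fun x (hx : |x| < t) => (abs_lt.1 hx).1.le
      _ = gaussTail (-t - μ) := gaussianReal_real_Ici μ (-t)
      _ ≤ gaussTail b := antitone_gaussTail (by linarith)

theorem measurableSet_le_abs (t : ℝ) : MeasurableSet {x : ℝ | t ≤ |x|} :=
  measurableSet_le measurable_const (by fun_prop)

theorem measurableSet_abs_lt (t : ℝ) : MeasurableSet {x : ℝ | |x| < t} :=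
  measurableSet_lt (by fun_prop) measurable_const

theorem le_gaussianReal_real_le_abs {μ t b : ℝ} (h : t + b ≤ |μ|) :
    gaussTail (-b) ≤ (gaussianReal μ 1).real {x | t ≤ |x|} := by
  have hc : {x : ℝ | t ≤ |x|} = {x : ℝ | |x| < t}ᶜ := by ext x; simp
  rw [hc, probReal_compl_eq_one_sub (measurableSet_abs_lt t), gaussTail_neg]
  exact sub_le_sub_left (gaussianReal_real_abs_lt_le h) 1

theorem gaussianReal_zero_real_le_abs_le (t : ℝ) :
    (gaussianReal 0 1).real {x | t ≤ |x|} ≤ 2 * gaussTail t := by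
  have hsub : {x : ℝ | t ≤ |x|} ⊆ Set.Ici t ∪ Set.Iic (-t) := fun x (hx : t ≤ |x|) => by
    rcases le_abs.1 hx with h | h
    · exact Or.inl h
    · exact Or.inr (le_neg.1 h)
  refine (measureReal_mono hsub).trans ((measureReal_union_le _ _).trans_eq ?_)
  rw [gaussianReal_real_Ici, gaussianReal_real_Iic]
  ring_nf

theorem FNR_oracle_le {n s : ℕ} (hs : 1 ≤ s) {b : ℝ} {θ : Fin n → ℝ}
    (hθ : θ ∈ boundaryClass n s b) : FNR θ (oracleProcedure n s) ≤ gaussTail b := by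
  set t := oracleThreshold n s
  have hs' : (1 : ℝ) ≤ s := by exact_mod_cast hs
  have hB : ∀ i, MeasurableSet {x : Fin n → ℝ | x i ∈ {y : ℝ | |y| < t}} := fun i =>
    measurable_pi_apply i (measurableSet_abs_lt t)
  have hpt : ∀ x, FNP θ (oracleProcedure n s) x =
      (∑ i ∈ support θ, {x : Fin n → ℝ | x i ∈ {y : ℝ | |y| < t}}.indicator 1 x) / s := fun x => by
    rw [FNP, sum_ite_eq_card_support, hθ.1, max_eq_right hs', sum_ite_ne_zero]
    congr 1
    refine Finset.sum_congr rfl fun i _ => ?_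
    by_cases hi : θ i = 0 <;> simp [hi, oracleProcedure, Set.indicator_apply, t]
  rw [FNR]
  simp_rw [hpt]
  rw [integral_div, integral_finsetSum _ fun i _ => (integrable_const 1).indicator (hB i),
    div_le_iff₀ (by linarith)]
  calc _ ≤ ∑ i ∈ support θ, gaussTail b := by
        refine Finset.sum_le_sum fun i hi => ?_
        rw [integral_indicator_one (hB i), dataLaw_real_eval θ i (measurableSet_abs_lt t)]
        exact gaussianReal_real_abs_lt_le (hθ.2 i hi)
    _ = gaussTail b * s := by rw [Finset.sum_const, hθ.1, nsmul_eq_mul, mul_comm]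

/-- FDP is at most V/w, with V the number of false rejections, unless there are fewer than `w` true
rejections. The first term is controlled through the mean of V, the second by Chebyshev. -/
theorem FDR_oracle_le {n s : ℕ} (hs : 1 ≤ s) (hsn : s ≤ n) (ht : 0 < oracleThreshold n s) {b : ℝ}
    {θ : Fin n → ℝ} (hθ : θ ∈ boundaryClass n s b) :
    FDR θ (oracleProcedure n s) ≤
      4 / (oracleThreshold n s * gaussTail (-b)) + 4 / (s * gaussTail (-b) ^ 2) := by
  set t := oracleThreshold n s
  set c := gaussTail (-b)
  have hc : 0 < c := gaussTail_pos _
  have hs0 : (0 : ℝ) < s := by exact_mod_cast hs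
  have hn0 : (0 : ℝ) < n := by exact_mod_cast hs.trans hsn
  set D : Set ℝ := {y : ℝ | t ≤ |y|}
  have hD : MeasurableSet D := measurableSet_le_abs t
  have hE : ∀ i, MeasurableSet {x : Fin n → ℝ | x i ∈ D} := fun i => measurable_pi_apply i hD
  set X : Fin n → ℝ → ℝ := fun i => if i ∈ support θ then D.indicator 1 else 0
  have hXm : ∀ i, Measurable (X i) := fun i => by
    simp only [X]; split_ifs
    exacts [measurable_one.indicator hD, measurable_zero]
  have hX01 : ∀ i y, X i y = 0 ∨ X i y = 1 := fun i y => by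
    simp only [X]; split_ifs
    · by_cases hy : y ∈ D <;> simp [hy]
    · simp
  -- Half of a lower bound for the mean number of true rejections: each signal is detected with
  -- probability at least `c`.
  set w : ℝ := s * c / 2
  have hw : 0 < w := by positivity
  set B : Set (Fin n → ℝ) := {x | ∑ i, X i (x i) < w}
  have hB : MeasurableSet B := measurableSet_lt (by fun_prop) measurable_const
  have hXmem : ∀ i, MemLp (X i) 2 (gaussianReal (θ i) 1) := fun i =>
    MemLp.of_bound (hXm i).aestronglyMeasurable 1 (ae_of_all _ fun y => by
      rcases hX01 i y with h | h <;> simp [h])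
  have hXint : ∀ i ∈ support θ, ∫ y, X i y ∂gaussianReal (θ i) 1 =
      (gaussianReal (θ i) 1).real D := fun i hi => by
    simp only [X, hi, if_true]
    exact integral_indicator_one hD
  have hPB : (dataLaw θ).real B ≤ s / w ^ 2 := by
    refine dataLaw_real_sum_le θ hXmem hw ?_ ?_
    · rw [← Finset.sum_subset (Finset.subset_univ (support θ)) fun i _ hi => by simp [X, hi]]
      calc w + w = ∑ i ∈ support θ, c := by
            rw [Finset.sum_const, hθ.1, nsmul_eq_mul]; simp only [w]; ring
        _ ≤ _ := Finset.sum_le_sum fun i hi => by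
            rw [hXint i hi]; exact le_gaussianReal_real_le_abs (hθ.2 i hi)
    · rw [← Finset.sum_subset (Finset.subset_univ (support θ)) fun i _ hi => by simp [X, hi]]
      calc _ ≤ ∑ i ∈ support θ, (1 : ℝ) := Finset.sum_le_sum fun i hi => by
            have h2 : ∀ y, X i y ^ 2 = X i y := fun y => by
              rcases hX01 i y with h | h <;> simp [h]
            simp_rw [h2]
            rw [hXint i hi]
            exact measureReal_le_one
        _ = s := by rw [Finset.sum_const, hθ.1, nsmul_eq_mul, mul_one]
  set V : (Fin n → ℝ) → ℝ := fun x => ∑ i ∈ (support θ)ᶜ, {x : Fin n → ℝ | x i ∈ D}.indicator 1 x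
  have hVnn : ∀ x, 0 ≤ V x := fun x => Finset.sum_nonneg fun i _ =>
    Set.indicator_nonneg (fun _ _ => zero_le_one) _
  have hVi : ∀ i ∈ (support θ)ᶜ,
      Integrable ({x : Fin n → ℝ | x i ∈ D}.indicator (1 : (Fin n → ℝ) → ℝ)) (dataLaw θ) :=
    fun i _ => (integrable_const 1).indicator (hE i)
  have hVint : Integrable V (dataLaw θ) := integrable_finsetSum _ hVi
  have hEV : ∫ x, V x ∂dataLaw θ ≤ n * (2 * gaussTail t) := by
    rw [integral_finsetSum _ hVi]
    calc _ ≤ ∑ i ∈ (support θ)ᶜ, 2 * gaussTail t := Finset.sum_le_sum fun i hi => by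
          have hi0 : θ i = 0 := by simpa [support] using hi
          rw [integral_indicator_one (hE i), dataLaw_real_eval θ i hD, hi0]
          exact gaussianReal_zero_real_le_abs_le t
      _ = (support θ)ᶜ.card * (2 * gaussTail t) := by rw [Finset.sum_const, nsmul_eq_mul]
      _ ≤ _ := by
          have h1 : ((support θ)ᶜ.card : ℝ) ≤ n := by
            exact_mod_cast (Finset.card_le_univ _).trans_eq (Fintype.card_fin n)
          have h2 := gaussTail_nonneg t
          gcongr
  have hpt : ∀ x, FDP θ (oracleProcedure n s) x ≤ V x / w + B.indicator 1 x := fun x => by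
    by_cases hx : x ∈ B
    · rw [Set.indicator_of_mem hx]
      have h1 := (FDP_mem_Icc θ (oracleProcedure n s) x).2
      have h2 : 0 ≤ V x / w := div_nonneg (hVnn x) hw.le
      simp only [Pi.one_apply]
      linarith
    · rw [Set.indicator_of_notMem hx, add_zero]
      have hwx : w ≤ ∑ i, X i (x i) := le_of_not_gt hx
      have hnum : (∑ i, if θ i = 0 ∧ (oracleProcedure n s).reject x i = true then (1 : ℝ) else 0)
          = V x := by
        simp only [V]
        rw [← Finset.sum_subset (Finset.subset_univ (support θ)ᶜ) fun i _ hi => by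
          simp only [support, Finset.mem_compl, Finset.mem_filter_univ, not_not] at hi
          simp [hi]]
        refine Finset.sum_congr rfl fun i hi => ?_
        have hi0 : θ i = 0 := by simpa [support] using hi
        simp [hi0, oracleProcedure, Set.indicator_apply, D, t]
      rw [FDP, hnum]
      refine div_le_div_of_nonneg_left (hVnn x) hw (hwx.trans (le_max_of_le_right ?_))
      refine Finset.sum_le_sum fun i _ => ?_
      by_cases hi : i ∈ support θ <;> simp [X, hi, oracleProcedure, Set.indicator_apply, D, t]
      split_ifs <;> norm_num
  have hmain : FDR θ (oracleProcedure n s) ≤ n * (2 * gaussTail t) / w + s / w ^ 2 := by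
    calc FDR θ (oracleProcedure n s) ≤ ∫ x, (V x / w + B.indicator 1 x) ∂dataLaw θ :=
          integral_mono (integrable_FDP _ _)
            ((hVint.div_const w).add ((integrable_const 1).indicator hB)) hpt
      _ = (∫ x, V x ∂dataLaw θ) / w + (dataLaw θ).real B := by
          rw [← integral_indicator_one hB, ← integral_div]
          exact integral_add (hVint.div_const w) ((integrable_const 1).indicator hB)
      _ ≤ _ := by gcongr
  refine hmain.trans (add_le_add ?_ (le_of_eq ?_))
  · have htail : gaussTail t ≤ s / n / t := by
      refine (gaussTail_le_exp_div ht).trans_eq ?_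
      rw [Real.exp_neg, exp_oracleThreshold_sq hs hsn, inv_div]
    calc n * (2 * gaussTail t) / w ≤ n * (2 * (s / n / t)) / w := by gcongr
      _ = 4 / (t * c) := by simp only [w]; field_simp; norm_num
  · simp only [w]; field_simp; norm_num

theorem supRisk_oracle_le {n s : ℕ} (hs : 1 ≤ s) (hsn : s ≤ n) (ht : 0 < oracleThreshold n s)
    (b : ℝ) :
    supRisk (boundaryClass n s b) (oracleProcedure n s) ≤ gaussTail b +
      (4 / (oracleThreshold n s * gaussTail (-b)) + 4 / (s * gaussTail (-b) ^ 2)) := by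
  refine Real.iSup_le (fun θ => ?_) ?_
  · have h1 := FNR_oracle_le hs θ.2
    have h2 := FDR_oracle_le hs hsn ht θ.2
    rw [risk]
    linarith
  · have h1 := gaussTail_nonneg b
    have h2 := gaussTail_nonneg (-b)
    positivity

/-! ### Limits. -/

variable {s : ℕ → ℕ}

theorem tendsto_oracleThreshold
    (hns : Tendsto (fun n : ℕ => (n : ℝ) / (s n : ℝ)) atTop atTop) :
    Tendsto (fun n => oracleThreshold n (s n)) atTop atTop :=
  Real.tendsto_sqrt_atTop.comp
    ((Real.tendsto_log_atTop.comp hns).const_mul_atTop (zero_lt_two' ℝ))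

theorem eventually_two_mul_le (hs : Tendsto s atTop atTop)
    (hns : Tendsto (fun n : ℕ => (n : ℝ) / (s n : ℝ)) atTop atTop) :
    ∀ᶠ n in atTop, 1 ≤ s n ∧ 2 * s n ≤ n := by
  filter_upwards [hs.eventually_ge_atTop 1, hns.eventually_ge_atTop 2] with n h1 h2
  have h0 : (0 : ℝ) < s n := by exact_mod_cast h1
  rw [le_div_iff₀ h0] at h2
  exact ⟨h1, by exact_mod_cast h2⟩

theorem eventually_le_minimaxRisk (hs : Tendsto s atTop atTop)
    (hns : Tendsto (fun n : ℕ => (n : ℝ) / (s n : ℝ)) atTop atTop) (b : ℝ) {ε : ℝ} (hε : 0 < ε) :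
    ∀ᶠ n in atTop, gaussTail b - ε ≤ minimaxRisk (boundaryClass n (s n) b) := by
  have hp := gaussTail_pos b
  set p := gaussTail b
  -- `K` and `δ` each cost at most ε/4; the remaining ε/2 gives a strict inequality in the limit.
  set K : ℝ := max 1 (4 / ε)
  have hK1 : 1 ≤ K := le_max_left _ _
  have hKε : 1 / K ≤ ε / 4 := by
    rw [one_div_le (by linarith) (by linarith), one_div_div]
    exact le_max_right _ _
  set δ : ℝ := ε * p / (16 * K)
  have hδ : 0 < δ := by positivity
  have hδK : 4 * δ * K / p = ε / 4 := by
    simp only [δ]; field_simp; norm_num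
  have hsR : Tendsto (fun n => (s n : ℝ)) atTop atTop := tendsto_natCast_atTop_atTop.comp hs
  have ha : Tendsto (fun n => oracleThreshold n (s n) + b) atTop atTop :=
    tendsto_atTop_add_const_right _ _ (tendsto_oracleThreshold hns)
  have h1 : Tendsto (fun n => gaussTail (-b + (b ^ 2 / 2 + Real.log δ) /
      (oracleThreshold n (s n) + b))) atTop (𝓝 (gaussTail (-b))) := by
    refine (continuous_gaussTail.tendsto _).comp ?_
    simpa using (ha.const_div_atTop (b ^ 2 / 2 + Real.log δ)).const_add (-b)
  have h2 : Tendsto (fun n => 8 / (s n * p ^ 2)) atTop (𝓝 0) :=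
    (hsR.atTop_mul_const (by positivity)).const_div_atTop 8
  have h3 := ((h1.add h2).add_const (4 * δ * K / p)).const_sub (1 - 1 / K)
  have hlt : gaussTail b - ε < 1 - 1 / K - (gaussTail (-b) + 0 + 4 * δ * K / p) := by
    rw [hδK, gaussTail_neg]
    linarith
  filter_upwards [h3.eventually (lt_mem_nhds hlt), eventually_two_mul_le hs hns,
    ha.eventually_gt_atTop 0] with n hn1 hn2 hn3
  exact hn1.le.trans (le_minimaxRisk hn2.1 hn2.2 hn3 hK1 hδ)

theorem eventually_supRisk_oracle_le (hs : Tendsto s atTop atTop)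
    (hns : Tendsto (fun n : ℕ => (n : ℝ) / (s n : ℝ)) atTop atTop) (b : ℝ) {ε : ℝ} (hε : 0 < ε) :
    ∀ᶠ n in atTop,
      supRisk (boundaryClass n (s n) b) (oracleProcedure n (s n)) ≤ gaussTail b + ε := by
  have hc := gaussTail_pos (-b)
  set c := gaussTail (-b)
  have hsR : Tendsto (fun n => (s n : ℝ)) atTop atTop := tendsto_natCast_atTop_atTop.comp hs
  have ht := tendsto_oracleThreshold hns
  have h1 : Tendsto (fun n => 4 / (oracleThreshold n (s n) * c)) atTop (𝓝 0) :=
    (ht.atTop_mul_const hc).const_div_atTop 4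
  have h2 : Tendsto (fun n => 4 / (s n * c ^ 2)) atTop (𝓝 0) :=
    (hsR.atTop_mul_const (by positivity)).const_div_atTop 4
  have h3 := h1.add h2
  rw [add_zero] at h3
  filter_upwards [h3.eventually (gt_mem_nhds hε), eventually_two_mul_le hs hns,
    ht.eventually_gt_atTop 0] with n hn1 hn2 hn3
  exact (supRisk_oracle_le hn2.1 (by omega) hn3 b).trans (by linarith)

theorem tendsto_minimaxRisk (hs : Tendsto s atTop atTop)
    (hns : Tendsto (fun n : ℕ => (n : ℝ) / (s n : ℝ)) atTop atTop) (b : ℝ) :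
    Tendsto (fun n => minimaxRisk (boundaryClass n (s n) b)) atTop (𝓝 (gaussTail b)) := by
  refine tendsto_order.2 ⟨fun x hx => ?_, fun x hx => ?_⟩
  · filter_upwards [eventually_le_minimaxRisk hs hns b (half_pos (sub_pos.2 hx))] with n hn
    linarith
  · filter_upwards [eventually_supRisk_oracle_le hs hns b (half_pos (sub_pos.2 hx))] with n hn
    linarith [minimaxRisk_le_supRisk (boundaryClass n (s n) b) (oracleProcedure n (s n))]

theorem tendsto_supRisk_oracle (hs : Tendsto s atTop atTop)
    (hns : Tendsto (fun n : ℕ => (n : ℝ) / (s n : ℝ)) atTop atTop) (b : ℝ) :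
    Tendsto (fun n => supRisk (boundaryClass n (s n) b) (oracleProcedure n (s n))) atTop
      (𝓝 (gaussTail b)) := by
  refine tendsto_order.2 ⟨fun x hx => ?_, fun x hx => ?_⟩
  · filter_upwards [(tendsto_minimaxRisk hs hns b).eventually (lt_mem_nhds hx)] with n hn
    exact hn.trans_le (minimaxRisk_le_supRisk _ _)
  · filter_upwards [eventually_supRisk_oracle_le hs hns b (half_pos (sub_pos.2 hx))] with n hn
    linarith

/-- No uniformity in `b` is needed: eventually the class lies inside that of a fixed `b'` whose
limiting risk is already below the target. -/
theorem tendsto_supRisk_oracle_zero (hs : Tendsto s atTop atTop)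
    (hns : Tendsto (fun n : ℕ => (n : ℝ) / (s n : ℝ)) atTop atTop) {b : ℕ → ℝ}
    (hb : Tendsto b atTop atTop) :
    Tendsto (fun n => supRisk (boundaryClass n (s n) (b n)) (oracleProcedure n (s n))) atTop
      (𝓝 0) := by
  refine tendsto_order.2 ⟨fun x hx => Eventually.of_forall fun n =>
    hx.trans_le (supRisk_nonneg _ _), fun x hx => ?_⟩
  obtain ⟨b', hb'⟩ := (tendsto_gaussTail_atTop.eventually (gt_mem_nhds hx)).exists
  filter_upwards [(tendsto_supRisk_oracle hs hns b').eventually (gt_mem_nhds hb'),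
    hb.eventually_ge_atTop b'] with n hn1 hn2
  exact (supRisk_mono (boundaryClass_antitone n (s n) hn2) _).trans_lt hn1

theorem tendsto_minimaxRisk_zero (hs : Tendsto s atTop atTop)
    (hns : Tendsto (fun n : ℕ => (n : ℝ) / (s n : ℝ)) atTop atTop) {b : ℕ → ℝ}
    (hb : Tendsto b atTop atTop) :
    Tendsto (fun n => minimaxRisk (boundaryClass n (s n) (b n))) atTop (𝓝 0) :=
  squeeze_zero (fun _ => minimaxRisk_nonneg _) (fun _ => minimaxRisk_le_supRisk _ _)
    (tendsto_supRisk_oracle_zero hs hns hb)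

/-- Eventually the class contains that of a fixed `b'` with limit close to 1; rejecting nothing
gives the upper bound. -/
theorem tendsto_minimaxRisk_one (hs : Tendsto s atTop atTop)
    (hns : Tendsto (fun n : ℕ => (n : ℝ) / (s n : ℝ)) atTop atTop) {b : ℕ → ℝ}
    (hb : Tendsto b atTop atBot) :
    Tendsto (fun n => minimaxRisk (boundaryClass n (s n) (b n))) atTop (𝓝 1) := by
  refine tendsto_order.2 ⟨fun x hx => ?_, fun x hx => Eventually.of_forall fun n =>
    (minimaxRisk_le_one _).trans_lt hx⟩
  obtain ⟨b', hb'⟩ := (tendsto_gaussTail_atBot.eventually (lt_mem_nhds hx)).exists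
  filter_upwards [(tendsto_minimaxRisk hs hns b').eventually (lt_mem_nhds hb'),
    hb.eventually_le_atBot b'] with n hn1 hn2
  exact hn1.trans_le (minimaxRisk_mono (boundaryClass_antitone n (s n) hn2))

end MultipleTesting

theorem mainTheorem2 (s : ℕ → ℕ) (hs : Tendsto s atTop atTop)
    (hns : Tendsto (fun n : ℕ => (n : ℝ) / (s n : ℝ)) atTop atTop) :
    -- the minimax risk, for fixed `b` and for `b = b_n → ±∞`
    (∀ b : ℝ, Tendsto
      (fun n => MultipleTesting.minimaxRisk (MultipleTesting.boundaryClass n (s n) b)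
        - MultipleTesting.gaussTail b) atTop (𝓝 0)) ∧
    (∀ b : ℕ → ℝ, Tendsto b atTop atTop ∨ Tendsto b atTop atBot → Tendsto
      (fun n => MultipleTesting.minimaxRisk (MultipleTesting.boundaryClass n (s n) (b n))
        - MultipleTesting.gaussTail (b n)) atTop (𝓝 0)) ∧
    -- the phase transition from `0` to `1` as `b` decreases from `+∞` to `-∞`
    (Continuous MultipleTesting.gaussTail ∧ StrictAnti MultipleTesting.gaussTail ∧
      Tendsto MultipleTesting.gaussTail atTop (𝓝 0) ∧
      Tendsto MultipleTesting.gaussTail atBot (𝓝 1)) ∧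
    (∀ b : ℕ → ℝ, Tendsto b atTop atTop → Tendsto
      (fun n => MultipleTesting.minimaxRisk (MultipleTesting.boundaryClass n (s n) (b n)))
        atTop (𝓝 0)) ∧
    (∀ b : ℕ → ℝ, Tendsto b atTop atBot → Tendsto
      (fun n => MultipleTesting.minimaxRisk (MultipleTesting.boundaryClass n (s n) (b n)))
        atTop (𝓝 1)) ∧
    -- oracle thresholding is asymptotically minimax, for fixed `b` and for `b = b_n → +∞`
    (∀ b : ℝ, Tendsto
      (fun n => MultipleTesting.supRisk (MultipleTesting.boundaryClass n (s n) b)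
          (MultipleTesting.oracleProcedure n (s n))
        - MultipleTesting.minimaxRisk (MultipleTesting.boundaryClass n (s n) b))
        atTop (𝓝 0)) ∧
    (∀ b : ℕ → ℝ, Tendsto b atTop atTop → Tendsto
      (fun n => MultipleTesting.supRisk (MultipleTesting.boundaryClass n (s n) (b n))
          (MultipleTesting.oracleProcedure n (s n))
        - MultipleTesting.minimaxRisk (MultipleTesting.boundaryClass n (s n) (b n)))
        atTop (𝓝 0)) := by
  refine ⟨fun b => ?_, fun b hb => ?_, ⟨MultipleTesting.continuous_gaussTail,
    MultipleTesting.strictAnti_gaussTail, MultipleTesting.tendsto_gaussTail_atTop,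
    MultipleTesting.tendsto_gaussTail_atBot⟩,
    fun b hb => MultipleTesting.tendsto_minimaxRisk_zero hs hns hb,
    fun b hb => MultipleTesting.tendsto_minimaxRisk_one hs hns hb, fun b => ?_, fun b hb => ?_⟩
  · simpa using (MultipleTesting.tendsto_minimaxRisk hs hns b).sub_const
      (MultipleTesting.gaussTail b)
  · rcases hb with hb | hb
    · simpa using (MultipleTesting.tendsto_minimaxRisk_zero hs hns hb).sub
        (MultipleTesting.tendsto_gaussTail_atTop.comp hb)
    · simpa using (MultipleTesting.tendsto_minimaxRisk_one hs hns hb).sub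
        (MultipleTesting.tendsto_gaussTail_atBot.comp hb)
  · simpa using (MultipleTesting.tendsto_supRisk_oracle hs hns b).sub
      (MultipleTesting.tendsto_minimaxRisk hs hns b)
  · simpa using (MultipleTesting.tendsto_supRisk_oracle_zero hs hns hb).sub
      (MultipleTesting.tendsto_minimaxRisk_zero hs hns hb)
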